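/- For each integer $n\ge 1$ let $(D_{n,k})_{k\in\mathbb Z}$ be a real, strictly stationary sequence of random variables on a probability space $(\Omega_n,\mathcal A_n,P_n)$ (all these spaces may coincide) which is a martingale difference sequence with respect to a nested filtration $(\mathcal F_{n,k})_{k\in\mathbb Z}$: $\mathcal F_{n,k-1}\subseteq\mathcal F_{n,k}\subseteq\mathcal A_n$, $D_{n,k}$ is integrable and $\mathcal F_{n,k}$-measurable, and $E(D_{n,k}\mid\mathcal F_{n,k-1})=0$ a.s. for all $k\in\mathbb Z$. Assume that the family $(D_{n,1}^2)_{n\ge1}$ is uniformly integrable and that there are random variables $L_1,L_2,\dots$ on a common probability space such that, for every fixed $m\ge1$, $(D_{n,1},\dots,D_{n,m})$ converges in distribution to $(L_1,\dots,L_m)$ as $n\to\infty$. Suppose that the limit sequence $(L_j)_{j\ge1}$ is a (possibly degenerate) strictly stationary Gaussian sequence. Then $\lim_{n\to\infty}E(D_{n,1}^2)$ exists and is finite, and with $c\ge0$ defined by $$c^2=\lim_{n\to\infty}E(D_{n,1}^2)$$ one has $$\frac1m\sum_{j=1}^m L_j^2\to c^2\quad\text{in }L^1\text{ as }m\to\infty,$$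 and $$\frac1{\sqrt n}\sum_{k=1}^n D_{n,k}\Rightarrow cZ\quad\text{as }n\to\infty,$$ where $Z$ is a standard normal random variable and $\Rightarrow$ denotes convergence in distribution. -/

import Mathlib

open MeasureTheory ProbabilityTheory Filter Topology

/-- A real process indexed by `T` (here `ℤ` or `ℕ+`) is (strictly) stationary if its law, as a
random element of `T → ℝ`, is invariant under every shift of the index. -/
def IsStationaryProcess {T Ω : Type*} [Add T] {mΩ : MeasurableSpace Ω}
    (X : T → Ω → ℝ) (P : Measure Ω) : Prop :=
  ∀ h : T, IdentDistrib (fun ω (t : T) ↦ X (t + h) ω) (fun ω (t : T) ↦ X t ω) P P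

/-- `(X k)` is a martingale difference sequence with respect to the (nested) filtration `ℱ`. -/
structure IsMartingaleDifference {Ω : Type*} {mΩ : MeasurableSpace Ω}
    (X : ℤ → Ω → ℝ) (ℱ : Filtration ℤ mΩ) (P : Measure Ω) : Prop where
  adapted : StronglyAdapted ℱ X
  integrable : ∀ k, Integrable (X k) P
  condExp_eq_zero : ∀ k, P[X k | ℱ (k - 1)] =ᵐ[P] 0

/-- Uniform integrability of a family of real random variables `X i`, where `X i` may be defined
on its own probability space `(Ω i, P i)`:
`sup_i E(|X i| ; |X i| ≥ C) → 0` as `C → ∞`. -/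
def IsUniformlyIntegrableFamily {ι : Type*} {Ω : ι → Type*} {mΩ : ∀ i, MeasurableSpace (Ω i)}
    (X : ∀ i, Ω i → ℝ) (P : ∀ i, Measure (Ω i)) : Prop :=
  (∀ i, AEStronglyMeasurable (X i) (P i)) ∧
    ∀ ε : ℝ, 0 < ε → ∃ C : ℝ, ∀ i,
      ∫⁻ ω in {ω | C ≤ |X i ω|}, ENNReal.ofReal |X i ω| ∂(P i) ≤ ENNReal.ofReal ε

/-! Uniform integrability of the squares turns convergence in law into convergence of first and
second moments. The limit sequence thus inherits zero means and vanishing correlations from the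
martingale differences. Being Gaussian, it is pairwise independent, so the law of large numbers
(`tendsto_eLpNorm_average_sq`) gives its mean squares the constant limit `σ = E (L 1)²`, and `c =
√σ`.

The central limit theorem follows from a Lindeberg-type telescoping of characteristic functions
(`norm_charFun_sum_sub_le`). The martingale property kills the linear Taylor term, leaving a
weighted sum of `E[exp(i s S_k) (X_k² - σ)]`. These terms are not individually small. But the weight
changes little from `k` to `k + 1`, so `X_k² - σ` may be replaced by its mean over a block of fixed
length `m`. That mean is small in `L¹`: the law of large numbers handles the limit sequence,
`tendsto_integral_abs_average` transfers it to the array, and stationarity makes it uniform in `k`.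
-/

/-! ### Truncation and uniform integrability -/

/-- The part of `g` below `C` is paid for by a small `h`, the excess by uniform integrability. All
later truncations use this excess, not an indicator. -/
theorem mul_le_mul_add_max_sub {g h : ℝ} (C : ℝ) (h0 : 0 ≤ h) (h1 : h ≤ 1) :
    g * h ≤ C * h + max (g - C) 0 := by
  have : (g - C) * h ≤ max (g - C) 0 * 1 :=
    mul_le_mul (le_max_left _ _) h1 h0 (le_max_right _ _)
  linarith

theorem abs_sub_clip_le {x R : ℝ} (hR : 0 ≤ R) : |x - max (-R) (min R x)| ≤ max (|x| - R) 0 := by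
  grind

theorem MeasureTheory.Integrable.max_abs_sub {Ω : Type*} {mΩ : MeasurableSpace Ω} {P : Measure Ω}
    [IsFiniteMeasure P] {X : Ω → ℝ} (hX : Integrable X P) (C : ℝ) :
    Integrable (fun ω ↦ max (|X ω| - C) 0) P :=
  (hX.abs.sub (integrable_const C)).pos_part

theorem tendsto_integral_max_abs_sub {Ω : Type*} {mΩ : MeasurableSpace Ω} {P : Measure Ω}
    [IsFiniteMeasure P] {X : Ω → ℝ} (hX : Integrable X P) :
    Tendsto (fun C : ℝ ↦ ∫ ω, max (|X ω| - C) 0 ∂P) atTop (𝓝 0) := by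
  have h0 : ∫ _ : Ω, (0 : ℝ) ∂P = 0 := integral_zero Ω ℝ
  nth_rewrite 2 [← h0]
  refine tendsto_integral_filter_of_dominated_convergence (fun ω ↦ |X ω|)
    (Eventually.of_forall fun C ↦ (hX.max_abs_sub C).aestronglyMeasurable) ?_ hX.abs ?_
  · filter_upwards [eventually_ge_atTop 0] with C hC
    refine ae_of_all _ fun ω ↦ ?_
    rw [Real.norm_of_nonneg (le_max_right _ _)]
    exact max_le (by linarith) (abs_nonneg _)
  · refine ae_of_all _ fun ω ↦ tendsto_const_nhds.congr' ?_
    filter_upwards [eventually_ge_atTop |X ω|] with C hC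
    exact (max_eq_right (by linarith)).symm

namespace IsUniformlyIntegrableFamily

variable {ι : Type*} {Ω : ι → Type*} {mΩ : ∀ i, MeasurableSpace (Ω i)}
  {X : ∀ i, Ω i → ℝ} {P : ∀ i, Measure (Ω i)}

theorem integrable [∀ i, IsFiniteMeasure (P i)] (h : IsUniformlyIntegrableFamily X P) (i : ι) :
    Integrable (X i) (P i) := by
  refine ⟨h.1 i, ?_⟩
  obtain ⟨C, hC⟩ := h.2 1 one_pos
  rw [hasFiniteIntegral_iff_norm]
  simp only [Real.norm_eq_abs]
  have hle : ∀ ω, ENNReal.ofReal |X i ω| ≤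
      {ω | C ≤ |X i ω|}.indicator (fun ω ↦ ENNReal.ofReal |X i ω|) ω + ENNReal.ofReal C := by
    intro ω
    by_cases hω : C ≤ |X i ω|
    · rw [Set.indicator_of_mem (by exact hω)]
      exact le_self_add
    · exact (ENNReal.ofReal_le_ofReal (not_le.mp hω).le).trans le_add_self
  have hm : NullMeasurableSet {ω | C ≤ |X i ω|} (P i) :=
    nullMeasurableSet_le aemeasurable_const (h.1 i).aemeasurable.abs
  calc ∫⁻ ω, ENNReal.ofReal |X i ω| ∂(P i)
      ≤ ∫⁻ ω, ({ω | C ≤ |X i ω|}.indicator (fun ω ↦ ENNReal.ofReal |X i ω|) ω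
          + ENNReal.ofReal C) ∂(P i) := lintegral_mono hle
    _ = ∫⁻ ω in {ω | C ≤ |X i ω|}, ENNReal.ofReal |X i ω| ∂(P i)
          + ENNReal.ofReal C * P i Set.univ := by
        rw [lintegral_add_right _ measurable_const, lintegral_indicator₀ hm, lintegral_const]
    _ < ⊤ := ENNReal.add_lt_top.2 ⟨(hC i).trans_lt ENNReal.ofReal_lt_top,
        ENNReal.mul_lt_top ENNReal.ofReal_lt_top (measure_lt_top _ _)⟩

theorem exists_integral_max_sub_le [∀ i, IsFiniteMeasure (P i)]
    (h : IsUniformlyIntegrableFamily X P) {ε : ℝ} (hε : 0 < ε) :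
    ∃ C : ℝ, 0 ≤ C ∧ ∀ i, ∫ ω, max (|X i ω| - C) 0 ∂(P i) ≤ ε := by
  obtain ⟨C, hC⟩ := h.2 ε hε
  refine ⟨max C 0, le_max_right _ _, fun i ↦ ?_⟩
  have hm : NullMeasurableSet {ω | C ≤ |X i ω|} (P i) :=
    nullMeasurableSet_le aemeasurable_const (h.1 i).aemeasurable.abs
  rw [integral_eq_lintegral_of_nonneg_ae (ae_of_all _ fun ω ↦ by positivity)
    ((h.integrable i).max_abs_sub _).aestronglyMeasurable]
  refine ENNReal.toReal_le_of_le_ofReal hε.le (le_trans ?_ (hC i))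
  rw [← lintegral_indicator₀ hm]
  refine lintegral_mono fun ω ↦ ?_
  by_cases hω : C ≤ |X i ω|
  · rw [Set.indicator_of_mem (by exact hω)]
    exact ENNReal.ofReal_le_ofReal (max_le (by linarith [le_max_right C 0]) (abs_nonneg _))
  · rw [max_eq_right (by linarith [le_max_left C 0])]
    simp

end IsUniformlyIntegrableFamily

theorem abs_integral_sub_integral_clip_le {Ω : Type*} {mΩ : MeasurableSpace Ω} {P : Measure Ω}
    [IsFiniteMeasure P] {X : Ω → ℝ} (hX : Integrable X P) {R : ℝ} (hR : 0 ≤ R) :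
    |∫ ω, X ω ∂P - ∫ ω, max (-R) (min R (X ω)) ∂P| ≤ ∫ ω, max (|X ω| - R) 0 ∂P := by
  have hi : Integrable (fun ω ↦ max (-R) (min R (X ω))) P :=
    (integrable_const (-R)).sup ((integrable_const R).inf hX)
  rw [← integral_sub hX hi]
  exact abs_integral_le_integral_abs.trans (integral_mono (hX.sub hi).abs (hX.max_abs_sub R)
    fun ω ↦ abs_sub_clip_le hR)

/-- Convergence of the means of `F (X i)` for a continuous, possibly unbounded `F`, under uniform
integrability. -/
theorem MeasureTheory.TendstoInDistribution.tendsto_integral_of_max_abs_sub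
    {ι E Ω' : Type*} {Ω : ι → Type*} {mΩ : ∀ i, MeasurableSpace (Ω i)} {mΩ' : MeasurableSpace Ω'}
    {P : ∀ i, Measure (Ω i)} [∀ i, IsProbabilityMeasure (P i)]
    {P' : Measure Ω'} [IsProbabilityMeasure P']
    [TopologicalSpace E] [MeasurableSpace E] [OpensMeasurableSpace E]
    {X : ∀ i, Ω i → E} {Z : Ω' → E} {l : Filter ι} (h : TendstoInDistribution X l Z P P')
    {F : E → ℝ} (hF : Continuous F) (hZ : Integrable (fun ω ↦ F (Z ω)) P')
    (hX : ∀ i, Integrable (fun ω ↦ F (X i ω)) (P i))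
    (hUI : ∀ ε : ℝ, 0 < ε → ∃ R : ℝ, ∀ i, ∫ ω, max (|F (X i ω)| - R) 0 ∂(P i) ≤ ε) :
    Tendsto (fun i ↦ ∫ ω, F (X i ω) ∂(P i)) l (𝓝 (∫ ω, F (Z ω) ∂P')) := by
  rw [Metric.tendsto_nhds]
  intro ε hε
  obtain ⟨R₁, hR₁⟩ := hUI (ε / 4) (by positivity)
  -- One level serves the array and the limit, since the excess decreases in `R`. Two clipping
  -- errors and one weak-convergence error cost `ε / 4` each.
  obtain ⟨R, hR0, hR1, hR⟩ : ∃ R : ℝ, 0 ≤ R ∧ R₁ ≤ R ∧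
      ∫ ω, max (|F (Z ω)| - R) 0 ∂P' < ε / 4 :=
    ((eventually_ge_atTop 0).and ((eventually_ge_atTop R₁).and
      ((tendsto_integral_max_abs_sub hZ).eventually_lt_const (by positivity)))).exists
  let f : BoundedContinuousFunction E ℝ :=
    .ofNormedAddCommGroup (fun x ↦ max (-R) (min R (F x))) (by fun_prop) R (fun x ↦ by
      rw [Real.norm_eq_abs, abs_le]
      exact ⟨le_max_left _ _, max_le (by linarith) (min_le_left _ _)⟩)
  have hf : ∀ x, f x = max (-R) (min R (F x)) := fun x ↦ rfl
  have hw := ProbabilityMeasure.tendsto_iff_forall_integral_tendsto.1 h.tendsto f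
  simp only [ProbabilityMeasure.coe_mk] at hw
  rw [integral_map h.aemeasurable_limit f.continuous.measurable.aestronglyMeasurable] at hw
  filter_upwards [Metric.tendsto_nhds.1 hw (ε / 4) (by positivity)] with i hi
  rw [integral_map (h.forall_aemeasurable i) f.continuous.measurable.aestronglyMeasurable] at hi
  have h1 := abs_integral_sub_integral_clip_le (hX i) hR0
  have h2 := abs_integral_sub_integral_clip_le hZ hR0
  have h3 : ∫ ω, max (|F (X i ω)| - R) 0 ∂(P i) ≤ ε / 4 :=
    (integral_mono ((hX i).max_abs_sub R) ((hX i).max_abs_sub R₁)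
      fun ω ↦ max_le_max_right _ (by linarith)).trans (hR₁ i)
  simp only [hf] at hi
  rw [Real.dist_eq] at hi ⊢
  rw [abs_le] at h1 h2
  rw [abs_lt] at hi ⊢
  constructor <;> linarith [h1.1, h1.2, h2.1, h2.2, hi.1, hi.2]

/-! ### Taylor bounds and summation identities -/

/-- Cubic remainder for small `θ`, triangle inequality for large `θ`; the minimum keeps the bound
integrable under second moments alone. -/
theorem Complex.norm_exp_I_mul_sub_taylor_le (θ : ℝ) :
    ‖Complex.exp (Complex.I * θ) - 1 - Complex.I * θ + θ ^ 2 / 2‖ ≤ 4 * θ ^ 2 * min |θ| 1 := by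
  have hn : ‖Complex.I * θ‖ = |θ| := by simp
  rcases le_total |θ| 1 with h | h
  · have := Complex.exp_bound (x := Complex.I * θ) (by rwa [hn]) (n := 3) (by norm_num)
    rw [hn] at this
    have e : Complex.exp (Complex.I * θ) - ∑ m ∈ Finset.range 3, (Complex.I * θ) ^ m / m.factorial
        = Complex.exp (Complex.I * θ) - 1 - Complex.I * θ + θ ^ 2 / 2 := by
      simp [Finset.sum_range_succ, mul_pow]
      ring
    rw [e] at this
    rw [min_eq_left h]
    refine this.trans ?_
    have h3 : |θ| ^ 3 = θ ^ 2 * |θ| := by rw [← sq_abs θ]; ring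
    rw [h3]
    norm_num [Nat.factorial]
    nlinarith [mul_nonneg (sq_nonneg θ) (abs_nonneg θ)]
  · rw [min_eq_right h]
    have h1 : ‖Complex.exp (Complex.I * θ)‖ = 1 := by
      rw [mul_comm]; exact Complex.norm_exp_ofReal_mul_I θ
    have h4 : ‖(θ : ℂ) ^ 2 / 2‖ = θ ^ 2 / 2 := by simp
    calc _ ≤ ‖Complex.exp (Complex.I * θ)‖ + ‖(1 : ℂ)‖ + ‖Complex.I * θ‖ + ‖(θ : ℂ) ^ 2 / 2‖ :=
          (norm_add_le _ _).trans (add_le_add_left ((norm_sub_le _ _).trans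
            (add_le_add_left (norm_sub_le _ _) _)) _)
      _ = 1 + 1 + |θ| + θ ^ 2 / 2 := by rw [h1, hn, h4]; simp
      _ ≤ 4 * θ ^ 2 * 1 := by rw [← sq_abs θ]; nlinarith

theorem Real.abs_exp_neg_sub_one_add_le {y : ℝ} (hy : 0 ≤ y) : |Real.exp (-y) - 1 + y| ≤ y ^ 2 := by
  rcases le_total y 1 with h | h
  · have := Real.abs_exp_sub_one_sub_id_le (x := -y) (by rwa [abs_neg, abs_of_nonneg hy])
    simpa using this
  · have h1 := Real.add_one_le_exp (-y)
    have h2 : Real.exp (-y) ≤ 1 := Real.exp_le_one_iff.2 (by linarith)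
    rw [abs_of_nonneg (by linarith)]
    nlinarith

/-- Summation along rows of an array that is nearly constant along antidiagonals. -/
theorem norm_sum_range_sub_le_of_antidiagonal {e : ℕ → ℕ → ℂ} {ε G : ℝ}
    (h1 : ∀ k j, ‖e k (j + 1) - e (k + 1) j‖ ≤ ε) (h2 : ∀ k j, ‖e k j‖ ≤ G) (n j : ℕ) :
    ‖∑ k ∈ Finset.range n, e k j - ∑ k ∈ Finset.range n, e k 0‖ ≤ j * (n * ε + 2 * G) := by
  induction j with
  | zero => simp
  | succ j ih =>
    -- Sliding one step along the antidiagonals shifts the range of `k` by one, which leaves the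
    -- boundary terms `e n j - e 0 j`.
    have e1 : ∑ k ∈ Finset.range n, e k (j + 1) - ∑ k ∈ Finset.range n, e k 0 =
        ∑ k ∈ Finset.range n, (e k (j + 1) - e (k + 1) j) + (e n j - e 0 j)
        + (∑ k ∈ Finset.range n, e k j - ∑ k ∈ Finset.range n, e k 0) := by
      rw [← Finset.sum_range_sub (fun k ↦ e k j) n, Finset.sum_sub_distrib, Finset.sum_sub_distrib]
      ring
    rw [e1]
    have h3 : ‖∑ k ∈ Finset.range n, (e k (j + 1) - e (k + 1) j)‖ ≤ n * ε :=
      (norm_sum_le_of_le _ fun k _ ↦ h1 k j).trans (by simp)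
    have h4 : ‖e n j - e 0 j‖ ≤ 2 * G :=
      (norm_sub_le _ _).trans (by linarith [h2 n j, h2 0 j])
    refine (norm_add_le _ _).trans ((add_le_add ((norm_add_le _ _).trans (add_le_add h3 h4))
      ih).trans (le_of_eq ?_))
    push_cast; ring

theorem norm_sum_range_le_of_antidiagonal {e : ℕ → ℕ → ℂ} {ε G : ℝ} (hε : 0 ≤ ε) (hG : 0 ≤ G)
    (h1 : ∀ k j, ‖e k (j + 1) - e (k + 1) j‖ ≤ ε) (h2 : ∀ k j, ‖e k j‖ ≤ G) (n : ℕ) {m : ℕ}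
    (hm : 0 < m) :
    ‖∑ k ∈ Finset.range n, e k 0‖ ≤
      ‖∑ k ∈ Finset.range n, (m : ℂ)⁻¹ * ∑ j ∈ Finset.range m, e k j‖ + m * (n * ε + 2 * G) := by
  have hm' : (m : ℂ) ≠ 0 := by exact_mod_cast hm.ne'
  have e1 : ∑ k ∈ Finset.range n, e k 0 =
      ∑ k ∈ Finset.range n, (m : ℂ)⁻¹ * ∑ j ∈ Finset.range m, e k j
      - (m : ℂ)⁻¹ * ∑ j ∈ Finset.range m,
        (∑ k ∈ Finset.range n, e k j - ∑ k ∈ Finset.range n, e k 0) := by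
    rw [Finset.sum_sub_distrib, mul_sub, ← Finset.mul_sum, Finset.sum_comm]
    simp only [Finset.sum_const, Finset.card_range, nsmul_eq_mul]
    field_simp
    ring
  have hR : 0 ≤ n * ε + 2 * G := by positivity
  have h3 : ‖∑ j ∈ Finset.range m,
      (∑ k ∈ Finset.range n, e k j - ∑ k ∈ Finset.range n, e k 0)‖ ≤ m * (m * (n * ε + 2 * G)) := by
    refine (norm_sum_le_of_le _ fun j hj ↦ (?_ : _ ≤ m * (n * ε + 2 * G))).trans (by simp)
    refine (norm_sum_range_sub_le_of_antidiagonal h1 h2 n j).trans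
      (mul_le_mul_of_nonneg_right ?_ hR)
    exact_mod_cast (Finset.mem_range.1 hj).le
  rw [e1]
  refine (norm_sub_le _ _).trans (add_le_add_right ?_ _)
  rw [norm_mul, norm_inv, Complex.norm_natCast, inv_mul_le_iff₀ (by exact_mod_cast hm)]
  exact h3

/-- The sum telescopes, its summands being the increments of `q ^ (n - k) * φ k`. -/
theorem sum_range_pow_mul_sub (q : ℂ) (φ : ℕ → ℂ) (n : ℕ) :
    ∑ k ∈ Finset.range n, q ^ (n - 1 - k) * (φ (k + 1) - q * φ k) = φ n - q ^ n * φ 0 := by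
  induction n with
  | zero => simp
  | succ n ih =>
    have : ∑ k ∈ Finset.range n, q ^ (n + 1 - 1 - k) * (φ (k + 1) - q * φ k) =
        q * ∑ k ∈ Finset.range n, q ^ (n - 1 - k) * (φ (k + 1) - q * φ k) := by
      rw [Finset.mul_sum]
      refine Finset.sum_congr rfl fun k hk ↦ ?_
      have : n + 1 - 1 - k = (n - 1 - k) + 1 := by have := Finset.mem_range.1 hk; omega
      rw [this, pow_succ]; ring
    rw [Finset.sum_range_succ, this, ih]
    simp only [add_tsub_cancel_right, tsub_self, pow_zero]
    ring

/-! ### Characteristic functions of martingale sums -/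

section Lindeberg

variable {Ω : Type*} {mΩ : MeasurableSpace Ω} {P : Measure Ω} [IsProbabilityMeasure P]

theorem integral_sq_mul_min_le {X : Ω → ℝ} (hX : MemLp X 2 P) {s b C η : ℝ} (hC : 0 ≤ C)
    (hb : ∫ ω, |X ω| ∂P ≤ b) (hη : ∫ ω, max (X ω ^ 2 - C) 0 ∂P ≤ η) :
    ∫ ω, X ω ^ 2 * min |s * X ω| 1 ∂P ≤ C * |s| * b + η := by
  have hi : Integrable X P := hX.integrable (by norm_num)
  have hmax : Integrable (fun ω ↦ max (X ω ^ 2 - C) 0) P :=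
    (hX.integrable_sq.sub (integrable_const C)).pos_part
  calc ∫ ω, X ω ^ 2 * min |s * X ω| 1 ∂P
      ≤ ∫ ω, (C * |s| * |X ω| + max (X ω ^ 2 - C) 0) ∂P := by
        refine integral_mono_of_nonneg (ae_of_all _ fun ω ↦ by positivity)
          ((hi.abs.const_mul _).add hmax) (ae_of_all _ fun ω ↦ ?_)
        refine (mul_le_mul_add_max_sub C (by positivity) (min_le_right _ _)).trans ?_
        simp only [mul_assoc, ← abs_mul]
        gcongr
        exact min_le_left _ _
    _ = C * |s| * ∫ ω, |X ω| ∂P + ∫ ω, max (X ω ^ 2 - C) 0 ∂P := by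
        rw [integral_add (hi.abs.const_mul _) hmax, integral_const_mul]
    _ ≤ C * |s| * b + η := by gcongr

/-- One step of the telescoping: after second-order expansion of both exponentials the linear term
vanishes by `horth`. The `X² - σ` term is kept on the left because it becomes small only after block
averaging. -/
theorem norm_charFun_step_le {S X : Ω → ℝ} (hS : AEMeasurable S P) (hX : MemLp X 2 P)
    {s b C η σ : ℝ} (hσ : 0 ≤ σ) (hC : 0 ≤ C)
    (horth : ∫ ω, Complex.exp (Complex.I * (s * S ω : ℝ)) * X ω ∂P = 0)
    (hb : ∫ ω, |X ω| ∂P ≤ b) (hη : ∫ ω, max (X ω ^ 2 - C) 0 ∂P ≤ η) :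
    ‖(∫ ω, Complex.exp (Complex.I * (s * (S ω + X ω) : ℝ)) ∂P)
      - Real.exp (-(s ^ 2 * σ / 2)) * (∫ ω, Complex.exp (Complex.I * (s * S ω : ℝ)) ∂P)
      + (s ^ 2 / 2 : ℝ) * ∫ ω, Complex.exp (Complex.I * (s * S ω : ℝ)) * (X ω ^ 2 - σ : ℝ) ∂P‖
      ≤ 4 * s ^ 2 * (C * |s| * b + η) + (s ^ 2 * σ / 2) ^ 2 := by
  set y := s ^ 2 * σ / 2 with hy
  have hy0 : 0 ≤ y := by positivity
  have hXm := hX.aestronglyMeasurable.aemeasurable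
  have hE : AEStronglyMeasurable (fun ω ↦ Complex.exp (Complex.I * (s * S ω : ℝ))) P :=
    AEMeasurable.aestronglyMeasurable (by fun_prop)
  have hE1 : ∀ ω, ‖Complex.exp (Complex.I * (s * S ω : ℝ))‖ = 1 := fun ω ↦ by
    rw [mul_comm]; exact Complex.norm_exp_ofReal_mul_I _
  have hEi : Integrable (fun ω ↦ Complex.exp (Complex.I * (s * S ω : ℝ))) P :=
    Integrable.of_bound hE 1 (ae_of_all _ fun ω ↦ (hE1 ω).le)
  have hE2i : Integrable (fun ω ↦ Complex.exp (Complex.I * (s * (S ω + X ω) : ℝ))) P :=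
    Integrable.of_bound (AEMeasurable.aestronglyMeasurable (by fun_prop)) 1
      (ae_of_all _ fun ω ↦ by rw [mul_comm]; exact (Complex.norm_exp_ofReal_mul_I _).le)
  have hEg : Integrable (fun ω ↦ Complex.exp (Complex.I * (s * S ω : ℝ)) * (X ω ^ 2 - σ : ℝ)) P :=
    ((hX.integrable_sq.sub (integrable_const σ)).ofReal).bdd_mul hE
      (ae_of_all _ fun ω ↦ (hE1 ω).le)
  have hEX : Integrable (fun ω ↦ Complex.exp (Complex.I * (s * S ω : ℝ)) * X ω) P :=
    ((hX.integrable (by norm_num)).ofReal).bdd_mul hE (ae_of_all _ fun ω ↦ (hE1 ω).le)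
  have hm : Integrable (fun ω ↦ X ω ^ 2 * min |s * X ω| 1) P := by
    refine hX.integrable_sq.mul_bdd (c := 1) (AEMeasurable.aestronglyMeasurable (by fun_prop))
      (ae_of_all _ fun ω ↦ ?_)
    rw [Real.norm_of_nonneg (by positivity)]
    exact min_le_right _ _
  have e1 : (∫ ω, Complex.exp (Complex.I * (s * (S ω + X ω) : ℝ)) ∂P)
      - Real.exp (-y) * (∫ ω, Complex.exp (Complex.I * (s * S ω : ℝ)) ∂P)
      + (s ^ 2 / 2 : ℝ) * ∫ ω, Complex.exp (Complex.I * (s * S ω : ℝ)) * (X ω ^ 2 - σ : ℝ) ∂P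
      = ∫ ω, Complex.exp (Complex.I * (s * S ω : ℝ)) *
        ((Complex.exp (Complex.I * (s * X ω : ℝ)) - 1 - Complex.I * (s * X ω : ℝ)
          + ((s * X ω : ℝ) : ℂ) ^ 2 / 2) - (Real.exp (-y) - 1 + y : ℝ)) ∂P := by
    -- Subtracting a multiple of the vanishing integral in `horth` puts the linear Taylor term into
    -- the integrand.
    rw [← sub_zero (_ + _), ← mul_zero (Complex.I * s), ← horth, ← integral_const_mul,
      ← integral_const_mul, ← integral_const_mul, ← integral_sub hE2i (hEi.const_mul _),
      ← integral_add (by exact hE2i.sub (hEi.const_mul _)) (hEg.const_mul _),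
      ← integral_sub (by exact (hE2i.sub (hEi.const_mul _)).add (hEg.const_mul _))
        (hEX.const_mul _)]
    refine integral_congr_ae (ae_of_all _ fun ω ↦ ?_)
    simp only [mul_add, Complex.ofReal_add, Complex.exp_add, hy]
    push_cast
    ring
  rw [e1]
  calc _ ≤ ∫ ω, (4 * s ^ 2 * (X ω ^ 2 * min |s * X ω| 1) + y ^ 2) ∂P := by
        refine norm_integral_le_of_norm_le ((hm.const_mul _).add (integrable_const _))
          (ae_of_all _ fun ω ↦ ?_)
        rw [norm_mul, hE1, one_mul]
        refine (norm_sub_le _ _).trans (add_le_add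
          ((Complex.norm_exp_I_mul_sub_taylor_le _).trans (le_of_eq (by ring))) ?_)
        rw [Complex.norm_real]
        exact Real.abs_exp_neg_sub_one_add_le hy0
    _ = 4 * s ^ 2 * (∫ ω, X ω ^ 2 * min |s * X ω| 1 ∂P) + y ^ 2 := by
        rw [integral_add (hm.const_mul _) (integrable_const _), integral_const_mul]
        simp
    _ ≤ _ := by
        gcongr
        exact integral_sq_mul_min_le hX hC hb hη

/-- Here `A` will be the increment of a weight. The bound `hA` is used against `Y²` up to level `C`,
and `hA2` against the excess, since `|X| * Y²` need not be integrable. -/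
theorem norm_integral_mul_sq_sub_le {A : Ω → ℂ} {X Y : Ω → ℝ}
    (hX : Integrable X P) (hY : MemLp Y 2 P) {s b y C η σ : ℝ}
    (hσ : 0 ≤ σ) (hC : 0 ≤ C) (hA2 : ∀ ω, ‖A ω‖ ≤ 2) (hA : ∀ ω, ‖A ω‖ ≤ |s| * |X ω| + y)
    (hb : ∫ ω, |X ω| ∂P ≤ b) (hη : ∫ ω, max (Y ω ^ 2 - C) 0 ∂P ≤ η) :
    ‖∫ ω, A ω * (Y ω ^ 2 - σ : ℝ) ∂P‖ ≤ (C + σ) * (|s| * b + y) + 2 * η := by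
  have hmax : Integrable (fun ω ↦ max (Y ω ^ 2 - C) 0) P :=
    (hY.integrable_sq.sub (integrable_const C)).pos_part
  have hi : Integrable (fun ω ↦ |s| * |X ω| + y) P :=
    (hX.abs.const_mul _).add (integrable_const y)
  calc _ ≤ ∫ ω, ((C + σ) * (|s| * |X ω| + y) + 2 * max (Y ω ^ 2 - C) 0) ∂P := by
        refine norm_integral_le_of_norm_le ((hi.const_mul _).add (hmax.const_mul _))
          (ae_of_all _ fun ω ↦ ?_)
        rw [norm_mul, Complex.norm_real, Real.norm_eq_abs]
        have h1 : |Y ω ^ 2 - σ| ≤ Y ω ^ 2 + σ :=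
          (abs_sub _ _).trans (by rw [abs_of_nonneg (sq_nonneg _), abs_of_nonneg hσ])
        have h2 := mul_le_mul_add_max_sub (g := Y ω ^ 2) (h := ‖A ω‖ / 2) C (by positivity)
          (by linarith [hA2 ω])
        have h3 : ‖A ω‖ * |Y ω ^ 2 - σ| ≤ ‖A ω‖ * (Y ω ^ 2 + σ) := by gcongr
        have h4 : (C + σ) * ‖A ω‖ ≤ (C + σ) * (|s| * |X ω| + y) := by gcongr; exact hA ω
        linarith
    _ = (C + σ) * (|s| * (∫ ω, |X ω| ∂P) + y) + 2 * ∫ ω, max (Y ω ^ 2 - C) 0 ∂P := by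
        rw [integral_add (hi.const_mul _) (hmax.const_mul _), integral_const_mul,
          integral_const_mul, integral_add (hX.abs.const_mul _) (integrable_const y),
          integral_const_mul]
        simp
    _ ≤ _ := by gcongr

/-- A non-asymptotic bound between the characteristic function of a sum of martingale differences
and that of a centred Gaussian variable. -/
theorem norm_charFun_sum_sub_le {X : ℕ → Ω → ℝ} (hX : ∀ k, MemLp (X k) 2 P)
    {s b v C η δ σ : ℝ} (hσ : 0 ≤ σ) (hC : 0 ≤ C) {m : ℕ} (hm : 0 < m)
    (horth : ∀ k, ∫ ω, Complex.exp (Complex.I * (s * ∑ i ∈ Finset.range k, X i ω : ℝ)) * X k ω ∂P = 0)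
    (hv : ∀ k, ∫ ω, X k ω ^ 2 ∂P ≤ v) (hb : ∀ k, ∫ ω, |X k ω| ∂P ≤ b)
    (hη : ∀ k, ∫ ω, max (X k ω ^ 2 - C) 0 ∂P ≤ η)
    (hδ : ∀ k, ∫ ω, |(m : ℝ)⁻¹ * (∑ j ∈ Finset.range m, (X (k + j) ω ^ 2 - σ))| ∂P ≤ δ) (n : ℕ) :
    ‖(∫ ω, Complex.exp (Complex.I * (s * ∑ i ∈ Finset.range n, X i ω : ℝ)) ∂P)
      - Real.exp (-(s ^ 2 * σ / 2)) ^ n‖ ≤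
      n * (4 * s ^ 2 * (C * |s| * b + η) + (s ^ 2 * σ / 2) ^ 2) + s ^ 2 / 2 *
        (n * δ + m * (n * ((C + σ) * (|s| * b + s ^ 2 * σ / 2) + 2 * η) + 2 * (v + σ))) := by
  set y := s ^ 2 * σ / 2 with hy
  have hy0 : 0 ≤ y := by positivity
  set q := Real.exp (-y) with hq
  have hq0 : 0 ≤ q := (Real.exp_pos _).le
  have hq1 : q ≤ 1 := Real.exp_le_one_iff.2 (by linarith)
  have hqy : 1 - q ≤ y := by have := Real.add_one_le_exp (-y); linarith
  set E : ℕ → Ω → ℂ := fun k ω ↦ Complex.exp (Complex.I * (s * ∑ i ∈ Finset.range k, X i ω : ℝ))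
    with hEdef
  have hXm : ∀ k, AEMeasurable (X k) P := fun k ↦ (hX k).aestronglyMeasurable.aemeasurable
  have hSm : ∀ k, AEMeasurable (fun ω ↦ ∑ i ∈ Finset.range k, X i ω) P := fun k ↦
    Finset.aemeasurable_fun_sum _ fun i _ ↦ hXm i
  have hEm : ∀ k, AEStronglyMeasurable (E k) P := fun k ↦ by
    have := hSm k
    exact AEMeasurable.aestronglyMeasurable (by fun_prop)
  have hE1 : ∀ k ω, ‖E k ω‖ = 1 := fun k ω ↦ by
    simp only [hEdef]; rw [mul_comm]; exact Complex.norm_exp_ofReal_mul_I _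
  have hgi : ∀ k, Integrable (fun ω ↦ X k ω ^ 2 - σ) P := fun k ↦
    (hX k).integrable_sq.sub (integrable_const σ)
  have hb0 : 0 ≤ b := (integral_nonneg fun ω ↦ abs_nonneg _).trans (hb 0)
  have hη0 : 0 ≤ η := (integral_nonneg fun ω ↦ le_max_right _ _).trans (hη 0)
  have hv0 : 0 ≤ v := (integral_nonneg fun ω ↦ sq_nonneg _).trans (hv 0)
  set φ : ℕ → ℂ := fun k ↦ ∫ ω, E k ω ∂P with hφ
  -- The power of `q` stands for the Gaussian steps still to come. For `k ≥ n` truncated subtraction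
  -- makes it `1`, so the bounds below hold for every `k`.
  set B : ℕ → Ω → ℂ := fun k ω ↦ ((q ^ (n - 1 - k) : ℝ) : ℂ) * E k ω with hBdef
  have hBm : ∀ k, AEStronglyMeasurable (B k) P := fun k ↦ (hEm k).const_mul _
  have hqk : ∀ k, q ^ k ≤ 1 := fun k ↦ pow_le_one₀ hq0 hq1
  have hqk0 : ∀ k, 0 ≤ q ^ k := fun k ↦ pow_nonneg hq0 k
  have hB1 : ∀ k ω, ‖B k ω‖ ≤ 1 := fun k ω ↦ by
    simp only [hBdef]
    rw [norm_mul, hE1, mul_one, Complex.norm_real, Real.norm_of_nonneg (hqk0 _)]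
    exact hqk _
  have hBg : ∀ k l, Integrable (fun ω ↦ B k ω * (X l ω ^ 2 - σ : ℝ)) P := fun k l ↦
    (hgi l).ofReal.bdd_mul (hBm k) (ae_of_all _ fun ω ↦ hB1 k ω)
  set e : ℕ → ℕ → ℂ := fun k j ↦ ∫ ω, B k ω * (X (k + j) ω ^ 2 - σ : ℝ) ∂P with hedef
  have hBdiff : ∀ k ω, ‖B k ω - B (k + 1) ω‖ ≤ |s| * |X k ω| + y := by
    intro k ω
    have e1 : B k ω - B (k + 1) ω = ((q ^ (n - 1 - k) : ℝ) : ℂ) * (E k ω - E (k + 1) ω)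
        + ((q ^ (n - 1 - k) - q ^ (n - 1 - (k + 1)) : ℝ) : ℂ) * E (k + 1) ω := by
      simp only [hBdef]; push_cast; ring
    have e2 : E (k + 1) ω = E k ω * Complex.exp (Complex.I * (s * X k ω : ℝ)) := by
      simp only [hEdef, ← Complex.exp_add, Finset.sum_range_succ]
      push_cast; ring_nf
    have h1 : ‖E k ω - E (k + 1) ω‖ ≤ |s| * |X k ω| := by
      rw [e2, ← mul_one_sub, norm_mul, hE1, one_mul, norm_sub_rev, ← abs_mul]
      exact Real.norm_exp_I_mul_ofReal_sub_one_le
    have h2 : |q ^ (n - 1 - k) - q ^ (n - 1 - (k + 1))| ≤ y := by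
      rcases Nat.lt_or_ge k (n - 1) with hk | hk
      · have : n - 1 - k = (n - 1 - (k + 1)) + 1 := by omega
        rw [this, pow_succ, ← mul_sub_one, abs_mul, abs_of_nonneg (hqk0 _), abs_sub_comm,
          abs_of_nonneg (by linarith)]
        exact (mul_le_of_le_one_left (by linarith) (hqk _)).trans hqy
      · have : n - 1 - k = n - 1 - (k + 1) := by omega
        rw [this, sub_self, abs_zero]; exact hy0
    rw [e1]
    refine (norm_add_le _ _).trans (add_le_add ?_ ?_)
    · rw [norm_mul, Complex.norm_real, Real.norm_of_nonneg (hqk0 _)]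
      exact (mul_le_of_le_one_left (norm_nonneg _) (hqk _)).trans h1
    · rw [norm_mul, hE1, mul_one, Complex.norm_real]
      exact h2
  have he1 : ∀ k j, ‖e k (j + 1) - e (k + 1) j‖ ≤ (C + σ) * (|s| * b + y) + 2 * η := by
    intro k j
    have : e k (j + 1) - e (k + 1) j =
        ∫ ω, (B k ω - B (k + 1) ω) * (X (k + 1 + j) ω ^ 2 - σ : ℝ) ∂P := by
      simp only [hedef]
      rw [show k + (j + 1) = k + 1 + j by ring, ← integral_sub (hBg _ _) (hBg _ _)]
      simp only [sub_mul]
    rw [this]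
    refine norm_integral_mul_sq_sub_le ((hX k).integrable (by norm_num)) (hX _) hσ hC
      (fun ω ↦ (norm_sub_le _ _).trans (by linarith [hB1 k ω, hB1 (k + 1) ω])) (hBdiff k) (hb k)
      (hη _)
  have he2 : ∀ k j, ‖e k j‖ ≤ v + σ := by
    intro k j
    calc ‖e k j‖ ≤ ∫ ω, (X (k + j) ω ^ 2 + σ) ∂P := by
          refine norm_integral_le_of_norm_le ((hX _).integrable_sq.add (integrable_const σ))
            (ae_of_all _ fun ω ↦ ?_)
          rw [norm_mul, Complex.norm_real, Real.norm_eq_abs]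
          refine (mul_le_of_le_one_left (abs_nonneg _) (hB1 k ω)).trans ((abs_sub _ _).trans ?_)
          rw [abs_of_nonneg (sq_nonneg _), abs_of_nonneg hσ]
      _ = ∫ ω, X (k + j) ω ^ 2 ∂P + σ := by
          rw [integral_add (hX _).integrable_sq (integrable_const σ)]; simp
      _ ≤ v + σ := by gcongr; exact hv _
  -- Along a row the weight `B k` is fixed, so the average over `j` is `B k` times a block mean,
  -- which `hδ` controls.
  have he3 : ‖∑ k ∈ Finset.range n, (m : ℂ)⁻¹ * ∑ j ∈ Finset.range m, e k j‖ ≤ n * δ := by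
    refine (norm_sum_le_of_le _ fun k _ ↦ (?_ : _ ≤ δ)).trans (by simp)
    have : (m : ℂ)⁻¹ * ∑ j ∈ Finset.range m, e k j = ∫ ω, B k ω *
        ((m : ℝ)⁻¹ * (∑ j ∈ Finset.range m, (X (k + j) ω ^ 2 - σ)) : ℝ) ∂P := by
      simp only [hedef]
      rw [← integral_finsetSum _ fun j _ ↦ hBg _ _, ← integral_const_mul]
      refine integral_congr_ae (ae_of_all _ fun ω ↦ ?_)
      simp only [← Finset.mul_sum]
      push_cast
      ring
    rw [this]
    refine (norm_integral_le_of_norm_le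
      (((integrable_finsetSum (Finset.range m) fun j _ ↦ hgi (k + j)).const_mul _).abs)
      (ae_of_all _ fun ω ↦ ?_)).trans (hδ k)
    rw [norm_mul, Complex.norm_real, Real.norm_eq_abs]
    exact mul_le_of_le_one_left (abs_nonneg _) (hB1 k ω)
  have hT := norm_sum_range_le_of_antidiagonal (by positivity) (by positivity) he1 he2 n hm
  have hstep : ∀ k, ‖((q ^ (n - 1 - k) : ℝ) : ℂ) * (φ (k + 1) - q * φ k)
      + (s ^ 2 / 2 : ℝ) * e k 0‖ ≤ 4 * s ^ 2 * (C * |s| * b + η) + y ^ 2 := by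
    intro k
    have h := norm_charFun_step_le (hSm k) (hX k) hσ hC (horth k) (hb k) (hη k)
    simp only [← Finset.sum_range_succ] at h
    have : ((q ^ (n - 1 - k) : ℝ) : ℂ) * (φ (k + 1) - q * φ k) + (s ^ 2 / 2 : ℝ) * e k 0 =
        ((q ^ (n - 1 - k) : ℝ) : ℂ) * (φ (k + 1) - q * φ k
          + (s ^ 2 / 2 : ℝ) * ∫ ω, E k ω * (X k ω ^ 2 - σ : ℝ) ∂P) := by
      have : e k 0 = ((q ^ (n - 1 - k) : ℝ) : ℂ) * ∫ ω, E k ω * (X k ω ^ 2 - σ : ℝ) ∂P := by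
        simp only [hedef, hBdef, add_zero, mul_assoc]
        rw [integral_const_mul]
      rw [this]; ring
    rw [this, norm_mul, Complex.norm_real, Real.norm_of_nonneg (hqk0 _)]
    exact (mul_le_of_le_one_left (norm_nonneg _) (hqk _)).trans h
  have htel := sum_range_pow_mul_sub q φ n
  have hφ0 : φ 0 = 1 := by simp [hφ, hEdef]
  have efin : φ n - (q : ℂ) ^ n = ∑ k ∈ Finset.range n, (((q ^ (n - 1 - k) : ℝ) : ℂ) *
      (φ (k + 1) - q * φ k) + (s ^ 2 / 2 : ℝ) * e k 0)
      - (s ^ 2 / 2 : ℝ) * ∑ k ∈ Finset.range n, e k 0 := by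
    rw [Finset.sum_add_distrib, ← Finset.mul_sum, add_sub_cancel_right]
    push_cast
    rw [htel, hφ0, mul_one]
  change ‖φ n - (q : ℂ) ^ n‖ ≤ _
  rw [efin]
  refine (norm_sub_le _ _).trans (add_le_add ?_ ?_)
  · exact (norm_sum_le_of_le _ fun k _ ↦ hstep k).trans
      (by rw [Finset.sum_const, Finset.card_range, nsmul_eq_mul])
  · rw [norm_mul, Complex.norm_real, Real.norm_of_nonneg (by positivity)]
    gcongr
    exact hT.trans (by gcongr)

end Lindeberg

/-! ### Reindexing, stationarity and orthogonality -/

theorem Finset.sum_Icc_pnat_eq_sum_range {M : Type*} [AddCommMonoid M] (f : ℕ+ → M) (m : ℕ+) :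
    ∑ j ∈ Finset.Icc 1 m, f j = ∑ i ∈ Finset.range m, f i.succPNat := by
  refine Finset.sum_nbij' (fun j ↦ j.natPred) Nat.succPNat (fun j hj ↦ ?_) (fun i hi ↦ ?_)
    (fun j _ ↦ j.succPNat_natPred) (fun i _ ↦ i.natPred_succPNat)
    (fun j _ ↦ by rw [j.succPNat_natPred])
  · rw [Finset.mem_Icc] at hj
    have h1 : (j : ℕ) ≤ m := hj.2
    have h2 := j.natPred_add_one
    rw [Finset.mem_range]
    omega
  · rw [Finset.mem_range] at hi
    exact Finset.mem_Icc.2 ⟨one_le, (by exact hi : i + 1 ≤ (m : ℕ))⟩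

theorem Finset.sum_Icc_int_eq_sum_range {M : Type*} [AddCommMonoid M] (f : ℤ → M) (n : ℕ) :
    ∑ k ∈ Finset.Icc (1 : ℤ) n, f k = ∑ i ∈ Finset.range n, f (i + 1) := by
  refine Finset.sum_nbij' (fun k ↦ (k - 1).toNat) (fun i ↦ (i : ℤ) + 1) (fun j hj ↦ ?_)
    (fun i hi ↦ ?_) (fun j hj ↦ ?_) (fun i hi ↦ ?_) (fun j hj ↦ ?_)
  · rw [Finset.mem_Icc] at hj; rw [Finset.mem_range]; omega
  · rw [Finset.mem_range] at hi; rw [Finset.mem_Icc]; omega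
  · rw [Finset.mem_Icc] at hj; omega
  · omega
  · rw [Finset.mem_Icc] at hj; congr 1; omega

namespace IsStationaryProcess

variable {Ω : Type*} {mΩ : MeasurableSpace Ω} {P : Measure Ω}

theorem identDistrib_int {X : ℤ → Ω → ℝ} (h : IsStationaryProcess X P) (k : ℤ) :
    IdentDistrib (X k) (X 1) P P := by
  have := (h (k - 1)).comp (measurable_pi_apply (1 : ℤ))
  simpa [Function.comp_def] using this

theorem identDistrib_pnat {X : ℕ+ → Ω → ℝ} (h : IsStationaryProcess X P) (j : ℕ+) :
    IdentDistrib (X j) (X 1) P P := by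
  -- Shifts in `ℕ+` are never zero, so index `1` needs its own case.
  rcases eq_or_ne j 1 with rfl | hj
  · exact IdentDistrib.refl ((measurable_pi_apply 1).comp_aemeasurable (h 1).aemeasurable_snd)
  · obtain ⟨k, rfl⟩ := PNat.exists_eq_succ_of_ne_one hj
    have := (h k).comp (measurable_pi_apply (1 : ℕ+))
    simpa only [Function.comp_def, add_comm 1 k] using this

theorem integral_average_shift {X : ℤ → Ω → ℝ} (h : IsStationaryProcess X P) (σ : ℝ) (m k : ℕ) :
    ∫ ω, |(m : ℝ)⁻¹ * (∑ j ∈ Finset.range m, (X (((k + j : ℕ) : ℤ) + 1) ω ^ 2 - σ))| ∂P =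
      ∫ ω, |(m : ℝ)⁻¹ * (∑ j ∈ Finset.range m, (X ((j : ℤ) + 1) ω ^ 2 - σ))| ∂P := by
  have hF : Measurable fun x : ℤ → ℝ ↦
      |(m : ℝ)⁻¹ * (∑ j ∈ Finset.range m, (x ((j : ℤ) + 1) ^ 2 - σ))| := by fun_prop
  have := ((h k).comp hF).integral_eq
  simp only [Function.comp_def] at this
  rw [← this]
  congr! 8 with ω j hj
  push_cast; ring

end IsStationaryProcess

theorem IsMartingaleDifference.integral_smul_eq_zero {Ω : Type*} {mΩ : MeasurableSpace Ω}
    {P : Measure Ω} [IsFiniteMeasure P] {X : ℤ → Ω → ℝ} {ℱ : Filtration ℤ mΩ}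
    (h : IsMartingaleDifference X ℱ P) {E : Type*} [NormedAddCommGroup E] [NormedSpace ℝ E]
    [CompleteSpace E] {k : ℤ} {G : Ω → E} (hG : StronglyMeasurable[ℱ (k - 1)] G)
    (hi : Integrable (fun ω ↦ X k ω • G ω) P) : ∫ ω, X k ω • G ω ∂P = 0 := by
  have := condExp_bilin_of_stronglyMeasurable_left (m := ℱ (k - 1)) (μ := P)
    (ContinuousLinearMap.lsmul ℝ ℝ : ℝ →L[ℝ] E →L[ℝ] E).flip hG hi (h.integrable k)
  rw [← integral_condExp (ℱ.le (k - 1))]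
  refine integral_eq_zero_of_ae ?_
  filter_upwards [this, h.condExp_eq_zero k] with ω h1 h2
  refine h1.trans ?_
  simp [h2]

/-! ### Moments and law of large numbers for the limit sequence -/

section Limit

variable {Ω : ℕ+ → Type*} {mΩ : ∀ n, MeasurableSpace (Ω n)}
  {P : ∀ n, Measure (Ω n)} [∀ n, IsProbabilityMeasure (P n)]
  {Ω' : Type*} {mΩ' : MeasurableSpace Ω'} {P' : Measure Ω'} [IsProbabilityMeasure P']
  {D : ∀ n, ℤ → Ω n → ℝ} {L : ℕ+ → Ω' → ℝ}

/-- Quadratic growth suffices: above level `K * (1 + m * C)`, the excess of `|F|` is at most `K`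
times the sum of the excesses of the squares above `C`. -/
theorem tendsto_integral_of_abs_le_sum_sq {m : ℕ+}
    (hconv : TendstoInDistribution
      (fun (n : ℕ+) (ω : Ω n) (j : Finset.Icc (1 : ℕ+) m) ↦ D n ((j : ℕ+) : ℤ) ω) atTop
      (fun (ω : Ω') (j : Finset.Icc (1 : ℕ+) m) ↦ L (j : ℕ+) ω) P P')
    (hD : ∀ n k, MemLp (D n k) 2 (P n)) (hL : ∀ j, MemLp (L j) 2 P')
    (hUI : ∀ ε : ℝ, 0 < ε → ∃ C : ℝ, 0 ≤ C ∧
      ∀ n k, ∫ ω, max (D n k ω ^ 2 - C) 0 ∂(P n) ≤ ε)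
    {F : (Finset.Icc (1 : ℕ+) m → ℝ) → ℝ} (hF : Continuous F) {K : ℝ} (hK : 0 ≤ K)
    (hFK : ∀ x, |F x| ≤ K * (1 + ∑ j, x j ^ 2)) :
    Tendsto (fun n ↦ ∫ ω, F (fun j ↦ D n ((j : ℕ+) : ℤ) ω) ∂(P n)) atTop
      (𝓝 (∫ ω, F (fun j ↦ L j ω) ∂P')) := by
  refine hconv.tendsto_integral_of_max_abs_sub hF ?_ ?_ ?_
  · refine Integrable.mono' (((integrable_const 1).add (integrable_finsetSum Finset.univ
      fun (j : Finset.Icc (1 : ℕ+) m) _ ↦ (hL j).integrable_sq)).const_mul K)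
      (hF.measurable.comp_aemeasurable hconv.aemeasurable_limit).aestronglyMeasurable
      (ae_of_all _ fun ω ↦ hFK _)
  · intro n
    refine Integrable.mono' (((integrable_const 1).add (integrable_finsetSum Finset.univ
      fun (j : Finset.Icc (1 : ℕ+) m) _ ↦ (hD n ((j : ℕ+) : ℤ)).integrable_sq)).const_mul K)
      (hF.measurable.comp_aemeasurable (hconv.forall_aemeasurable n)).aestronglyMeasurable
      (ae_of_all _ fun ω ↦ hFK _)
  · intro ε hε
    obtain ⟨C, hC0, hC⟩ := hUI (ε / (K * m + 1)) (by positivity)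
    have hcard : (∑ _j : Finset.Icc (1 : ℕ+) m, C) = m * C := by simp
    refine ⟨K * (1 + m * C), fun n ↦ ?_⟩
    have hmax : ∀ k, Integrable (fun ω ↦ max (D n k ω ^ 2 - C) 0) (P n) := fun k ↦
      ((hD n k).integrable_sq.sub (integrable_const C)).pos_part
    calc _ ≤ ∫ ω, K * ∑ j : Finset.Icc (1 : ℕ+) m, max (D n ((j : ℕ+) : ℤ) ω ^ 2 - C) 0 ∂(P n) := by
          refine integral_mono_of_nonneg (ae_of_all _ fun ω ↦ le_max_right _ _)
            ((integrable_finsetSum _ fun j _ ↦ hmax _).const_mul K) (ae_of_all _ fun ω ↦ ?_)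
          refine max_le ?_ (mul_nonneg hK (Finset.sum_nonneg fun j _ ↦ le_max_right _ _))
          refine (sub_le_sub_right (hFK _) _).trans ?_
          rw [← mul_sub, ← hcard, add_sub_add_left_eq_sub, ← Finset.sum_sub_distrib]
          exact mul_le_mul_of_nonneg_left (Finset.sum_le_sum fun j _ ↦ le_max_left _ _) hK
      _ = K * ∑ j : Finset.Icc (1 : ℕ+) m,
            ∫ ω, max (D n ((j : ℕ+) : ℤ) ω ^ 2 - C) 0 ∂(P n) := by
          rw [integral_const_mul, integral_finsetSum _ fun j _ ↦ hmax _]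
      _ ≤ K * ∑ _j : Finset.Icc (1 : ℕ+) m, ε / (K * m + 1) := by
          gcongr
          exact hC _ _
      _ = (K * m) / (K * m + 1) * ε := by simp; ring
      _ ≤ ε := by
          refine mul_le_of_le_one_left hε.le (div_le_one_of_le₀ (by linarith) (by positivity))

theorem sq_le_sum_sq {ι : Type*} [Fintype ι] (x : ι → ℝ) (i : ι) : x i ^ 2 ≤ ∑ j, x j ^ 2 :=
  Finset.single_le_sum (f := fun j ↦ x j ^ 2) (fun _ _ ↦ sq_nonneg _) (Finset.mem_univ i)

theorem tendsto_integral_eval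
    (hconv : ∀ m : ℕ+, TendstoInDistribution
      (fun (n : ℕ+) (ω : Ω n) (j : Finset.Icc (1 : ℕ+) m) ↦ D n ((j : ℕ+) : ℤ) ω) atTop
      (fun (ω : Ω') (j : Finset.Icc (1 : ℕ+) m) ↦ L (j : ℕ+) ω) P P')
    (hD : ∀ n k, MemLp (D n k) 2 (P n)) (hL : ∀ j, MemLp (L j) 2 P')
    (hUI : ∀ ε : ℝ, 0 < ε → ∃ C : ℝ, 0 ≤ C ∧
      ∀ n k, ∫ ω, max (D n k ω ^ 2 - C) 0 ∂(P n) ≤ ε)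
    (j : ℕ+) :
    Tendsto (fun n ↦ ∫ ω, D n j ω ∂(P n)) atTop (𝓝 (∫ ω, L j ω ∂P')) := by
  let i : Finset.Icc (1 : ℕ+) j := ⟨j, Finset.mem_Icc.2 ⟨one_le, le_rfl⟩⟩
  refine tendsto_integral_of_abs_le_sum_sq (hconv j) hD hL hUI (F := fun x ↦ x i)
    (continuous_apply i) zero_le_one fun x ↦ ?_
  have := sq_le_sum_sq x i
  rw [abs_le]
  constructor <;> nlinarith [sq_nonneg (x i - 1), sq_nonneg (x i + 1)]

theorem tendsto_integral_mul_eval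
    (hconv : ∀ m : ℕ+, TendstoInDistribution
      (fun (n : ℕ+) (ω : Ω n) (j : Finset.Icc (1 : ℕ+) m) ↦ D n ((j : ℕ+) : ℤ) ω) atTop
      (fun (ω : Ω') (j : Finset.Icc (1 : ℕ+) m) ↦ L (j : ℕ+) ω) P P')
    (hD : ∀ n k, MemLp (D n k) 2 (P n)) (hL : ∀ j, MemLp (L j) 2 P')
    (hUI : ∀ ε : ℝ, 0 < ε → ∃ C : ℝ, 0 ≤ C ∧
      ∀ n k, ∫ ω, max (D n k ω ^ 2 - C) 0 ∂(P n) ≤ ε)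
    (j k : ℕ+) :
    Tendsto (fun n ↦ ∫ ω, D n j ω * D n k ω ∂(P n)) atTop (𝓝 (∫ ω, L j ω * L k ω ∂P')) := by
  let i₁ : Finset.Icc (1 : ℕ+) (max j k) := ⟨j, Finset.mem_Icc.2 ⟨one_le, le_max_left _ _⟩⟩
  let i₂ : Finset.Icc (1 : ℕ+) (max j k) := ⟨k, Finset.mem_Icc.2 ⟨one_le, le_max_right _ _⟩⟩
  refine tendsto_integral_of_abs_le_sum_sq (hconv _) hD hL hUI (F := fun x ↦ x i₁ * x i₂)
    (by fun_prop) zero_le_one fun x ↦ ?_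
  have h1 := sq_le_sum_sq x i₁
  have h2 := sq_le_sum_sq x i₂
  rw [abs_le]
  constructor <;> nlinarith [sq_nonneg (x i₁ - x i₂), sq_nonneg (x i₁ + x i₂)]

theorem tendsto_integral_abs_average
    (hconv : ∀ m : ℕ+, TendstoInDistribution
      (fun (n : ℕ+) (ω : Ω n) (j : Finset.Icc (1 : ℕ+) m) ↦ D n ((j : ℕ+) : ℤ) ω) atTop
      (fun (ω : Ω') (j : Finset.Icc (1 : ℕ+) m) ↦ L (j : ℕ+) ω) P P')
    (hD : ∀ n k, MemLp (D n k) 2 (P n)) (hL : ∀ j, MemLp (L j) 2 P')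
    (hUI : ∀ ε : ℝ, 0 < ε → ∃ C : ℝ, 0 ≤ C ∧
      ∀ n k, ∫ ω, max (D n k ω ^ 2 - C) 0 ∂(P n) ≤ ε)
    (σ : ℝ) (m : ℕ+) :
    Tendsto (fun n ↦ ∫ ω, |(m : ℝ)⁻¹ *
        (∑ j ∈ Finset.range m, (D n ((j : ℤ) + 1) ω ^ 2 - σ))| ∂(P n)) atTop
      (𝓝 (∫ ω, |(m : ℝ)⁻¹ * ∑ j ∈ Finset.Icc (1 : ℕ+) m, L j ω ^ 2 - σ| ∂P')) := by
  have hm : (m : ℝ) ≠ 0 := by positivity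
  have hm1 : (1 : ℝ) ≤ m := by exact_mod_cast (one_le : 1 ≤ m)
  have e1 : ∀ n ω, (m : ℝ)⁻¹ * (∑ j ∈ Finset.range m, (D n ((j : ℤ) + 1) ω ^ 2 - σ)) =
      (m : ℝ)⁻¹ * ∑ j : Finset.Icc (1 : ℕ+) m, D n ((j : ℕ+) : ℤ) ω ^ 2 - σ := by
    intro n ω
    rw [Finset.sum_coe_sort (Finset.Icc 1 m) (fun j ↦ D n ((j : ℕ+) : ℤ) ω ^ 2),
      Finset.sum_Icc_pnat_eq_sum_range, Finset.sum_sub_distrib, mul_sub]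
    simp [hm]
  have e2 : ∀ ω, ∑ j ∈ Finset.Icc (1 : ℕ+) m, L j ω ^ 2 =
      ∑ j : Finset.Icc (1 : ℕ+) m, L j ω ^ 2 := fun ω ↦
    (Finset.sum_coe_sort (Finset.Icc 1 m) (fun j ↦ L j ω ^ 2)).symm
  simp only [e1, e2]
  refine tendsto_integral_of_abs_le_sum_sq (hconv m) hD hL hUI
    (F := fun x ↦ |(m : ℝ)⁻¹ * ∑ j, x j ^ 2 - σ|) (by fun_prop) (K := 1 + |σ|) (by positivity)
    fun x ↦ ?_
  have h0 : 0 ≤ ∑ j, x j ^ 2 := Finset.sum_nonneg fun j _ ↦ sq_nonneg _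
  have h1 : (m : ℝ)⁻¹ * ∑ j, x j ^ 2 ≤ ∑ j, x j ^ 2 :=
    mul_le_of_le_one_left h0 (inv_le_one_of_one_le₀ hm1)
  rw [abs_abs]
  refine (abs_sub _ _).trans ?_
  rw [abs_of_nonneg (by positivity)]
  nlinarith [abs_nonneg σ, mul_nonneg (abs_nonneg σ) h0]

end Limit

/-- The strong law in `L¹` for the squares of a stationary, pairwise uncorrelated, centred Gaussian
sequence. -/
theorem tendsto_eLpNorm_average_sq {Ω' : Type*} {mΩ' : MeasurableSpace Ω'} {P' : Measure Ω'}
    [IsProbabilityMeasure P'] {L : ℕ+ → Ω' → ℝ} (hLstat : IsStationaryProcess L P')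
    (hLgauss : IsGaussianProcess L P') (h0 : ∀ j, ∫ ω, L j ω ∂P' = 0)
    (h1 : ∀ i j, i < j → ∫ ω, L i ω * L j ω ∂P' = 0) :
    Tendsto (fun m : ℕ+ ↦ eLpNorm (fun ω ↦ ((m : ℝ)⁻¹ * ∑ j ∈ Finset.Icc (1 : ℕ+) m, (L j ω) ^ 2)
      - ∫ ω, L 1 ω ^ 2 ∂P') 1 P') atTop (𝓝 0) := by
  have hL2 : ∀ j, MemLp (L j) 2 P' := fun j ↦ (hLgauss.hasGaussianLaw_eval j).memLp_two
  have hind : ∀ i j, i < j → IndepFun (L i) (L j) P' := fun i j hij ↦ by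
    refine hLgauss.hasGaussianLaw_prodMk.indepFun_of_covariance_eq_zero ?_
    rw [covariance_eq_sub (hL2 i) (hL2 j), h0 i, zero_mul, sub_zero]
    exact h1 i j hij
  have hind' : ∀ i j, i ≠ j → IndepFun (L i) (L j) P' := fun i j hij ↦
    hij.lt_or_gt.elim (hind i j) fun h ↦ (hind j i h).symm
  have hsq : Measurable fun x : ℝ ↦ x ^ 2 := by fun_prop
  -- Pairwise independence is enough here; joint independence is never needed.
  have := strong_law_Lp le_rfl ENNReal.one_ne_top (μ := P') (fun i ω ↦ L i.succPNat ω ^ 2)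
    (memLp_one_iff_integrable.2 (hL2 _).integrable_sq)
    (fun i j hij ↦ (hind' _ _ (Nat.succPNat_injective.ne hij)).comp hsq hsq)
    (fun i ↦ ((hLstat.identDistrib_pnat _).trans (hLstat.identDistrib_pnat _).symm).comp hsq)
  have h := this.comp tendsto_PNat_val_atTop_atTop
  refine h.congr fun m ↦ ?_
  simp only [Function.comp_apply, Finset.sum_Icc_pnat_eq_sum_range, smul_eq_mul]
  rfl

/-! ### Convergence of characteristic functions -/

theorem IsMartingaleDifference.integral_exp_mul_eq_zero {Ω : Type*} {mΩ : MeasurableSpace Ω}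
    {P : Measure Ω} [IsFiniteMeasure P] {X : ℤ → Ω → ℝ} {ℱ : Filtration ℤ mΩ}
    (h : IsMartingaleDifference X ℱ P) (s : ℝ) (k : ℕ) :
    ∫ ω, Complex.exp (Complex.I * (s * ∑ i ∈ Finset.range k, X ((i : ℤ) + 1) ω : ℝ))
      * X ((k : ℤ) + 1) ω ∂P = 0 := by
  have hG : StronglyMeasurable[ℱ ((k : ℤ) + 1 - 1)]
      (fun ω ↦ Complex.exp (Complex.I * (s * ∑ i ∈ Finset.range k, X ((i : ℤ) + 1) ω : ℝ))) := by
    have hs : StronglyMeasurable[ℱ ((k : ℤ) + 1 - 1)]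
        (fun ω ↦ ∑ i ∈ Finset.range k, X ((i : ℤ) + 1) ω) := by
      refine Finset.stronglyMeasurable_fun_sum _ fun i hi ↦ (h.adapted _).mono (ℱ.mono ?_)
      have := Finset.mem_range.1 hi
      omega
    exact (by fun_prop : Continuous fun x : ℝ ↦
      Complex.exp (Complex.I * (s * x : ℝ))).comp_stronglyMeasurable hs
  rw [← h.integral_smul_eq_zero hG]
  · refine integral_congr_ae (ae_of_all _ fun ω ↦ ?_)
    simp only [Complex.real_smul, mul_comm]
  · refine (h.integrable _).smul_bdd 1 (hG.mono (ℱ.le _)).aestronglyMeasurable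
      (ae_of_all _ fun ω ↦ ?_)
    rw [mul_comm]
    exact (Complex.norm_exp_ofReal_mul_I _).le

theorem IsMartingaleDifference.integral_mul_eq_zero {Ω : Type*} {mΩ : MeasurableSpace Ω}
    {P : Measure Ω} [IsFiniteMeasure P] {X : ℤ → Ω → ℝ} {ℱ : Filtration ℤ mΩ}
    (h : IsMartingaleDifference X ℱ P) (hX : ∀ k, MemLp (X k) 2 P) {i j : ℤ} (hij : i < j) :
    ∫ ω, X i ω * X j ω ∂P = 0 := by
  rw [← h.integral_smul_eq_zero (k := j) (G := X i) ((h.adapted i).mono (ℱ.mono (by omega)))]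
  · simp only [smul_eq_mul, mul_comm]
  · exact (hX j).integrable_mul (hX i)

theorem IsMartingaleDifference.integral_eq_zero {Ω : Type*} {mΩ : MeasurableSpace Ω}
    {P : Measure Ω} [IsFiniteMeasure P] {X : ℤ → Ω → ℝ} {ℱ : Filtration ℤ mΩ}
    (h : IsMartingaleDifference X ℱ P) (k : ℤ) : ∫ ω, X k ω ∂P = 0 := by
  have := h.integral_smul_eq_zero (k := k) (G := fun _ ↦ (1 : ℝ)) stronglyMeasurable_const
    (by simpa using h.integrable k)
  simpa using this

/-- With `s = t / √n` the factor `n` disappears: as `s → 0` only terms in `η`, `δ` and `m * η`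
survive. -/
theorem charFun_lindeberg_bound_eq {n s t C b η σ δ m v : ℝ} (h : n * s ^ 2 = t ^ 2) :
    n * (4 * s ^ 2 * (C * |s| * b + η) + (s ^ 2 * σ / 2) ^ 2) + s ^ 2 / 2 *
        (n * δ + m * (n * ((C + σ) * (|s| * b + s ^ 2 * σ / 2) + 2 * η) + 2 * (v + σ))) =
      4 * t ^ 2 * (C * |s| * b + η) + t ^ 2 * s ^ 2 * σ ^ 2 / 4 + t ^ 2 / 2 *
        (δ + m * ((C + σ) * (|s| * b + s ^ 2 * σ / 2) + 2 * η)) + s ^ 2 * (m * (v + σ)) := by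
  rw [← h]; ring

theorem tendsto_integral_exp_sum {Ω : ℕ+ → Type*} {mΩ : ∀ n, MeasurableSpace (Ω n)}
    {P : ∀ n, Measure (Ω n)} [∀ n, IsProbabilityMeasure (P n)] {D : ∀ n, ℤ → Ω n → ℝ}
    {ℱ : ∀ n, Filtration ℤ (mΩ n)} (hmart : ∀ n, IsMartingaleDifference (D n) (ℱ n) (P n))
    (hD : ∀ n k, MemLp (D n k) 2 (P n))
    (hUI : ∀ ε : ℝ, 0 < ε → ∃ C : ℝ, 0 ≤ C ∧
      ∀ n k, ∫ ω, max (D n k ω ^ 2 - C) 0 ∂(P n) ≤ ε) {σ : ℝ} (hσ : 0 ≤ σ)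
    (hav : ∀ ε : ℝ, 0 < ε → ∃ m : ℕ+, ∀ᶠ n in atTop, ∀ k : ℕ, ∫ ω, |(m : ℝ)⁻¹ *
      (∑ j ∈ Finset.range m, (D n (((k + j : ℕ) : ℤ) + 1) ω ^ 2 - σ))| ∂(P n) ≤ ε) (t : ℝ) :
    Tendsto (fun n : ℕ+ ↦ ∫ ω, Complex.exp (Complex.I *
      (t * (√(n : ℝ))⁻¹ * ∑ i ∈ Finset.range n, D n ((i : ℤ) + 1) ω : ℝ)) ∂(P n)) atTop
      (𝓝 (Real.exp (-(t ^ 2 * σ / 2)) : ℝ)) := by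
  obtain ⟨v, hv0, hv⟩ : ∃ v : ℝ, 0 ≤ v ∧ ∀ n k, ∫ ω, D n k ω ^ 2 ∂(P n) ≤ v := by
    obtain ⟨C, hC0, hC⟩ := hUI 1 one_pos
    refine ⟨C + 1, by positivity, fun n k ↦ ?_⟩
    have hi : Integrable (fun ω ↦ max (D n k ω ^ 2 - C) 0) (P n) :=
      ((hD n k).integrable_sq.sub (integrable_const C)).pos_part
    calc _ ≤ ∫ ω, (C + max (D n k ω ^ 2 - C) 0) ∂(P n) :=
          integral_mono (hD n k).integrable_sq ((integrable_const C).add hi) fun ω ↦ by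
            dsimp only; linarith [le_max_left (D n k ω ^ 2 - C) 0]
      _ = C + ∫ ω, max (D n k ω ^ 2 - C) 0 ∂(P n) := by
          rw [integral_add (integrable_const C) hi]; simp
      _ ≤ C + 1 := by gcongr; exact hC n k
  have hb : ∀ n k, ∫ ω, |D n k ω| ∂(P n) ≤ 1 + v := fun n k ↦ by
    calc _ ≤ ∫ ω, (1 + D n k ω ^ 2) ∂(P n) :=
          integral_mono ((hD n k).integrable (by norm_num)).abs
            ((integrable_const 1).add (hD n k).integrable_sq) fun ω ↦ by
            dsimp only; rw [← sq_abs]; nlinarith [sq_nonneg (|D n k ω| - 1)]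
      _ = 1 + ∫ ω, D n k ω ^ 2 ∂(P n) := by
          rw [integral_add (integrable_const 1) (hD n k).integrable_sq]; simp
      _ ≤ 1 + v := by gcongr; exact hv n k
  rw [Metric.tendsto_nhds]
  intro ε hε
  -- The surviving error is at most `(4 + 3/2) * t ^ 2 * ε₁`, hence below `ε`.
  set ε₁ := ε / (6 * t ^ 2 + 1) with hε₁
  have hε₁0 : 0 < ε₁ := by positivity
  obtain ⟨m, hm⟩ := hav ε₁ hε₁0
  have hm0 : (0 : ℝ) < m := by positivity
  -- Moving across a block multiplies `η` by `m`, so `m` is fixed before `η` and `C`, and `n` comes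
  -- last.
  set η := ε₁ / m with hη
  have hmη : m * η = ε₁ := by rw [hη]; field_simp
  have hη1 : η ≤ ε₁ := div_le_self hε₁0.le (by exact_mod_cast (one_le : 1 ≤ m))
  obtain ⟨C, hC0, hC⟩ := hUI η (by positivity)
  set U : ℝ → ℝ := fun s ↦ 4 * t ^ 2 * (C * |s| * (1 + v) + η) + t ^ 2 * s ^ 2 * σ ^ 2 / 4
    + t ^ 2 / 2 * (ε₁ + m * ((C + σ) * (|s| * (1 + v) + s ^ 2 * σ / 2) + 2 * η))
    + s ^ 2 * (m * (v + σ)) with hU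
  have hUc : Continuous U := by fun_prop
  have hU0 : U 0 < ε := by
    have h1 : U 0 = 4 * t ^ 2 * η + t ^ 2 / 2 * (ε₁ + 2 * ε₁) := by
      simp only [hU, abs_zero]
      linear_combination t ^ 2 * hmη
    have h2 : ε₁ * (6 * t ^ 2 + 1) = ε := by rw [hε₁]; field_simp
    nlinarith [mul_le_mul_of_nonneg_left hη1 (sq_nonneg t), mul_nonneg (sq_nonneg t) hε₁0.le]
  have hs : Tendsto (fun n : ℕ+ ↦ t * (√(n : ℝ))⁻¹) atTop (𝓝 0) := by
    have : Tendsto (fun n : ℕ+ ↦ √(n : ℝ)) atTop atTop :=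
      Real.tendsto_sqrt_atTop.comp (tendsto_natCast_atTop_atTop.comp tendsto_PNat_val_atTop_atTop)
    simpa using this.inv_tendsto_atTop.const_mul t
  filter_upwards [hm, ((hUc.tendsto 0).comp hs).eventually_lt_const hU0] with n hn hUn
  have hns : ((n : ℕ) : ℝ) * (t * (√(n : ℝ))⁻¹) ^ 2 = t ^ 2 := by
    rw [mul_pow, inv_pow, Real.sq_sqrt (by positivity)]
    field_simp
  have key := norm_charFun_sum_sub_le (P := P n) (X := fun i ↦ D n ((i : ℤ) + 1))
    (fun k ↦ hD n _) (s := t * (√(n : ℝ))⁻¹) hσ hC0 m.pos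
    (fun k ↦ (hmart n).integral_exp_mul_eq_zero _ k) (fun k ↦ hv n _) (fun k ↦ hb n _)
    (fun k ↦ hC n _) hn n
  rw [charFun_lindeberg_bound_eq hns] at key
  have hexp : Real.exp (-((t * (√(n : ℝ))⁻¹) ^ 2 * σ / 2)) ^ (n : ℕ) =
      Real.exp (-(t ^ 2 * σ / 2)) := by
    rw [← Real.exp_nat_mul, ← hns]; ring_nf
  rw [dist_eq_norm, ← hexp]
  push_cast at key ⊢
  exact key.trans_lt hUn

/-- Lévy's continuity theorem, applied along `ℕ` via `Nat.succPNat` and carried back by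
`PNat.natPred`. -/
theorem tendstoInDistribution_of_tendsto_charFun_pnat {Ω : ℕ+ → Type*}
    {mΩ : ∀ n, MeasurableSpace (Ω n)} {P : ∀ n, Measure (Ω n)} [∀ n, IsProbabilityMeasure (P n)]
    {Ω' : Type*} {mΩ' : MeasurableSpace Ω'} {P' : Measure Ω'} [IsProbabilityMeasure P']
    {X : ∀ n, Ω n → ℝ} {Y : Ω' → ℝ} (hX : ∀ n, AEMeasurable (X n) (P n)) (hY : AEMeasurable Y P')
    (h : ∀ t, Tendsto (fun n ↦ charFun ((P n).map (X n)) t) atTop (𝓝 (charFun (P'.map Y) t))) :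
    TendstoInDistribution X atTop Y P P' := by
  refine ⟨hX, hY, ?_⟩
  have hsucc : Tendsto Nat.succPNat atTop atTop :=
    tendsto_atTop.2 fun b ↦ (eventually_ge_atTop (b : ℕ)).mono fun n hn ↦
      (by exact hn.trans (Nat.le_succ n) : (b : ℕ) ≤ n.succPNat)
  have hpred : Tendsto PNat.natPred atTop atTop :=
    tendsto_atTop.2 fun b ↦ (eventually_ge_atTop b.succPNat).mono fun n hn ↦ by
      have h1 : b + 1 ≤ (n : ℕ) := hn
      have h2 := n.natPred_add_one
      omega
  have := (ProbabilityMeasure.tendsto_iff_tendsto_charFun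
    (μ := fun n : ℕ ↦ ⟨(P n.succPNat).map (X n.succPNat), Measure.isProbabilityMeasure_map (hX _)⟩)
    (μ₀ := ⟨P'.map Y, Measure.isProbabilityMeasure_map hY⟩)).2 fun t ↦ (h t).comp hsucc
  refine (this.comp hpred).congr fun n ↦ ?_
  have key : ∀ k, k = n → (P k).map (X k) = (P n).map (X n) := by rintro _ rfl; rfl
  exact Subtype.ext (key _ n.succPNat_natPred)

theorem mainTheorem4
    {Ω : ℕ+ → Type*} {mΩ : ∀ n, MeasurableSpace (Ω n)}
    (P : ∀ n, Measure (Ω n)) [∀ n, IsProbabilityMeasure (P n)]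
    {Ω' : Type*} {mΩ' : MeasurableSpace Ω'} (P' : Measure Ω') [IsProbabilityMeasure P']
    {Ω'' : Type*} {mΩ'' : MeasurableSpace Ω''} (P'' : Measure Ω'') [IsProbabilityMeasure P'']
    -- the triangular array and its row filtrations
    (D : ∀ n, ℤ → Ω n → ℝ) (ℱ : ∀ n, Filtration ℤ (mΩ n))
    (hstat : ∀ n, IsStationaryProcess (D n) (P n))
    (hmart : ∀ n, IsMartingaleDifference (D n) (ℱ n) (P n))
    (hUI : IsUniformlyIntegrableFamily (fun n ω ↦ (D n 1 ω) ^ 2) P)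
    -- the limit variables `L 1, L 2, …`
    (L : ℕ+ → Ω' → ℝ)
    (hconv : ∀ m : ℕ+, TendstoInDistribution
      (fun (n : ℕ+) (ω : Ω n) (j : Finset.Icc (1 : ℕ+) m) ↦ D n ((j : ℕ+) : ℤ) ω) atTop
      (fun (ω : Ω') (j : Finset.Icc (1 : ℕ+) m) ↦ L (j : ℕ+) ω) P P')
    (hLstat : IsStationaryProcess L P')
    (hLgauss : IsGaussianProcess L P')
    -- a standard normal variable
    (Z : Ω'' → ℝ) (hZ : HasLaw Z (gaussianReal 0 1) P'') :
    ∃ c : ℝ, 0 ≤ c ∧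
      Tendsto (fun n : ℕ+ ↦ ∫ ω, (D n 1 ω) ^ 2 ∂(P n)) atTop (𝓝 (c ^ 2)) ∧
      Tendsto (fun m : ℕ+ ↦ eLpNorm
        (fun ω ↦ ((m : ℝ)⁻¹ * ∑ j ∈ Finset.Icc (1 : ℕ+) m, (L j ω) ^ 2) - c ^ 2) 1 P')
        atTop (𝓝 0) ∧
      TendstoInDistribution
        (fun (n : ℕ+) (ω : Ω n) ↦ (Real.sqrt (n : ℝ))⁻¹ * ∑ k ∈ Finset.Icc (1 : ℤ) (n : ℤ), D n k ω)
        atTop (fun ω ↦ c * Z ω) P P'' := by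
  have hid : ∀ n k, IdentDistrib (D n k) (D n 1) (P n) (P n) := fun n k ↦
    (hstat n).identDistrib_int k
  have hD1 : ∀ n, MemLp (D n 1) 2 (P n) := fun n ↦
    (memLp_two_iff_integrable_sq ((hmart n).integrable 1).aestronglyMeasurable).2 (hUI.integrable n)
  have hD : ∀ n k, MemLp (D n k) 2 (P n) := fun n k ↦ (hid n k).symm.memLp_snd (hD1 n)
  have hL : ∀ j, MemLp (L j) 2 P' := fun j ↦ (hLgauss.hasGaussianLaw_eval j).memLp_two
  have hUI' : ∀ ε : ℝ, 0 < ε → ∃ C : ℝ, 0 ≤ C ∧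
      ∀ n k, ∫ ω, max (D n k ω ^ 2 - C) 0 ∂(P n) ≤ ε := by
    intro ε hε
    obtain ⟨C, hC0, hC⟩ := hUI.exists_integral_max_sub_le hε
    refine ⟨C, hC0, fun n k ↦ ?_⟩
    have h1 := ((hid n k).comp (by fun_prop : Measurable fun x : ℝ ↦ max (x ^ 2 - C) 0)).integral_eq
    simp only [Function.comp_apply] at h1
    rw [h1]
    simpa only [abs_sq] using hC n
  set σ := ∫ ω, L 1 ω ^ 2 ∂P' with hσdef
  have hσ : 0 ≤ σ := integral_nonneg fun ω ↦ sq_nonneg _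
  have hσc : √σ ^ 2 = σ := Real.sq_sqrt hσ
  have hL0 : ∀ j, ∫ ω, L j ω ∂P' = 0 := fun j ↦ by
    refine tendsto_nhds_unique (tendsto_integral_eval hconv hD hL hUI' j) ?_
    simp only [(hmart _).integral_eq_zero]
    exact tendsto_const_nhds
  have hL1 : ∀ i j, i < j → ∫ ω, L i ω * L j ω ∂P' = 0 := fun i j hij ↦ by
    refine tendsto_nhds_unique (tendsto_integral_mul_eval hconv hD hL hUI' i j) ?_
    have : ∀ n, ∫ ω, D n i ω * D n j ω ∂(P n) = 0 := fun n ↦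
      (hmart n).integral_mul_eq_zero (hD n) (by exact_mod_cast hij)
    simp only [this]
    exact tendsto_const_nhds
  have hLLN := tendsto_eLpNorm_average_sq hLstat hLgauss hL0 hL1
  rw [← hσdef] at hLLN
  refine ⟨√σ, Real.sqrt_nonneg _, ?_, ?_, ?_⟩
  · rw [hσc, hσdef]
    simpa only [sq] using! tendsto_integral_mul_eval hconv hD hL hUI' 1 1
  · rw [hσc]
    exact hLLN
  · have hav : ∀ ε : ℝ, 0 < ε → ∃ m : ℕ+, ∀ᶠ n in atTop, ∀ k : ℕ, ∫ ω, |(m : ℝ)⁻¹ *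
        (∑ j ∈ Finset.range m, (D n (((k + j : ℕ) : ℤ) + 1) ω ^ 2 - σ))| ∂(P n) ≤ ε := by
      intro ε hε
      -- A single block length is fixed in the limit; its strict bound then passes to all large `n`.
      obtain ⟨m, hm⟩ := (hLLN.eventually_lt_const (ENNReal.ofReal_pos.2 hε)).exists
      refine ⟨m, ?_⟩
      have hlt : ∫ ω, |(m : ℝ)⁻¹ * ∑ j ∈ Finset.Icc (1 : ℕ+) m, L j ω ^ 2 - σ| ∂P' < ε := by
        have hi : Integrable (fun ω ↦ (m : ℝ)⁻¹ * ∑ j ∈ Finset.Icc (1 : ℕ+) m, L j ω ^ 2 - σ) P' :=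
          ((integrable_finsetSum _ fun j _ ↦ (hL j).integrable_sq).const_mul _).sub
            (integrable_const σ)
        have := integral_norm_eq_lintegral_enorm hi.aestronglyMeasurable
        rw [← eLpNorm_one_eq_lintegral_enorm] at this
        simp only [Real.norm_eq_abs] at this
        rw [this]
        exact (ENNReal.lt_ofReal_iff_toReal_lt hm.ne_top).1 hm
      filter_upwards [(tendsto_integral_abs_average hconv hD hL hUI' σ m).eventually_lt_const hlt]
        with n hn k
      rw [(hstat n).integral_average_shift]
      exact hn.le
    have hDm : ∀ n k, AEMeasurable (D n k) (P n) := fun n k ↦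
      (hD n k).aestronglyMeasurable.aemeasurable
    have hSm : ∀ n : ℕ+, AEMeasurable (fun ω ↦ (√(n : ℝ))⁻¹ *
        ∑ k ∈ Finset.Icc (1 : ℤ) (n : ℤ), D n k ω) (P n) := fun n ↦
      (Finset.aemeasurable_fun_sum _ fun k _ ↦ hDm n k).const_mul _
    refine tendstoInDistribution_of_tendsto_charFun_pnat hSm (hZ.aemeasurable.const_mul _) fun t ↦ ?_
    rw [charFun_map_mul_comp hZ.aemeasurable, hZ.map_eq, charFun_gaussianReal]
    convert tendsto_integral_exp_sum hmart hD hUI' hσ hav t using 2 with n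
    · rw [charFun_apply_real, integral_map (hSm n) (by fun_prop)]
      refine integral_congr_ae (ae_of_all _ fun ω ↦ ?_)
      dsimp only
      rw [show ((n : ℕ+) : ℤ) = ((n : ℕ) : ℤ) from rfl, Finset.sum_Icc_int_eq_sum_range]
      push_cast
      ring_nf
    · have : t ^ 2 * σ = (√σ * t) ^ 2 := by rw [mul_pow, hσc, mul_comm]
      rw [this]
      push_cast
      ring_nf
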